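/- Let $H$ be a finite group, let $r\ge 1$ be an integer, and let $\mathbb F_r$ be the free group of rank $r$. Let $\Gamma = H\wr\mathbb F_r$ be the restricted wreath product, i.e. the group of all pairs $(\varphi,x)$ with $x\in\mathbb F_r$ and $\varphi\colon\mathbb F_r\to H$ equal to the identity at all but finitely many points, with product $(\varphi_1,x_1)(\varphi_2,x_2)=(\varphi_1\cdot x_1\varphi_2,\;x_1x_2)$, where $(x\varphi)(y)=\varphi(x^{-1}y)$. Let $S$ be any finite symmetric generating set of $\Gamma$ and let $\mathcal G=(\Gamma,E)$ be the corresponding right Cayley graph (distinct $u,v\in\Gamma$ are adjacent if and only if $u^{-1}v\in S$), on which $\Gamma$ acts by left multiplication. Write $o$ for the identity element of $\Gamma$, $\deg(o)$ for its degree in $\mathcal G$ and $|g|$ for the graph distance from $o$ to $g$ in $\mathcal G$. Then there exists a constant $C>0$ (depending only on $\Gamma$ and $S$) such that for every real $\alpha<1$ there exist a $\Gamma$-invariant bond percolation $\mathbf P$ on $\mathcal G$, i.e. a probability measure on the subsets $\omega$ of $E$ (with the product $\sigma$-algebra) that is invariant under the action of $\Gamma$, and real numbers $\beta,\gamma>0$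 with $\beta/\gamma\le C$, such that $$\mathbb E[\deg_\omega(o)]>\alpha\,\deg(o)\qquad\text{and}\qquad e^{-\beta|g|}\le\tau(o,g)\le e^{-\gamma|g|}\quad\text{for all } g\in\Gamma .$$ Here $\deg_\omega(o)$ is the degree of $o$ in the graph with vertex set $\Gamma$ and edge set $\omega$, and $\tau(o,g)$ is the probability that $o$ and $g$ lie in the same connected component of this graph. -/

import Mathlib

open MeasureTheory

/-- The (standard, restricted) wreath product `H ≀ G`: the pairs `(φ, x)` with `x ∈ G` and
`φ : G → H` equal to the identity at all but finitely many points, as a subgroup of the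
unrestricted regular wreath product. The product is
`(φ₁, x₁) (φ₂, x₂) = (φ₁ · (x₁ φ₂), x₁ x₂)`, where `(x φ)(y) = φ (x⁻¹ y)`. -/
def RestrictedWreathProduct (H G : Type*) [Group H] [Group G] :
    Subgroup (RegularWreathProduct H G) where
  carrier := {a | (Function.mulSupport a.left).Finite}
  one_mem' := by simp
  mul_mem' := by
    intro a b ha hb
    have hb' : (Function.mulSupport fun x ↦ b.left (a.right⁻¹ * x)).Finite :=
      Set.Finite.preimage (mul_right_injective a.right⁻¹).injOn hb
    exact (ha.union hb').subset (Function.mulSupport_mul _ _)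
  inv_mem' := by
    intro a ha
    have ha' : (Function.mulSupport fun x ↦ a.left (a.right * x)).Finite :=
      Set.Finite.preimage (mul_right_injective a.right).injOn ha
    refine ha'.subset fun x hx ↦ ?_
    simpa using hx

/-- The lamplighter group `H ≀ 𝔽_r` over the free group of rank `r`. -/
abbrev LamplighterGroup (H : Type*) [Group H] (r : ℕ) : Type _ :=
  RestrictedWreathProduct H (FreeGroup (Fin r))

/-- The number of neighbours of the vertex `v` in the graph `G`
(used for locally finite graphs only). -/
noncomputable def vertexDegree {V : Type*} (G : SimpleGraph V) (v : V) : ℕ :=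
  (G.neighborSet v).ncard

namespace CayleyPercolation

variable {Γ : Type*} [Group Γ] (S : Set Γ)

/-- The word length `|g|`, i.e. the graph distance from the identity to `g` in the right Cayley
graph with respect to `S` (the graph in which `u ≠ v` are adjacent iff `u⁻¹ v ∈ S ∪ S⁻¹`). -/
noncomputable def wordLength (g : Γ) : ℕ :=
  (SimpleGraph.mulCayley S).dist 1 g

/-- A configuration of a bond percolation: a subset of the edge set of the Cayley graph. The set
of configurations carries the product σ-algebra. -/
abbrev Config : Type _ := Set (SimpleGraph.mulCayley S).edgeSet

/-- Left multiplication by `g` as an automorphism of the right Cayley graph. -/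
def translate (g : Γ) : SimpleGraph.mulCayley S ≃g SimpleGraph.mulCayley S where
  toEquiv := Equiv.mulLeft g
  map_rel_iff' := by simp

/-- The action of `g` on configurations: the edge `[u, v]` is moved to `[g u, g v]`. -/
def translateConfig (g : Γ) (ω : Config S) : Config S :=
  (translate S g).mapEdgeSet '' ω

/-- `P` is a `Γ`-invariant bond percolation on the Cayley graph: a probability measure on the set
of configurations that is invariant under the action of `Γ`. -/
structure IsInvariantBondPercolation (P : Measure (Config S)) : Prop where
  isProbabilityMeasure : IsProbabilityMeasure P
  invariant : ∀ g : Γ, MeasurePreserving (translateConfig S g) P P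

variable {S}

/-- The subgraph induced by a configuration: all vertices, and exactly the edges in `ω`. Its
connected components are the clusters of `ω`. -/
def openSubgraph (ω : Config S) : SimpleGraph Γ :=
  SimpleGraph.fromEdgeSet ((fun e : (SimpleGraph.mulCayley S).edgeSet ↦ (e : Sym2 Γ)) '' ω)

/-- The expected degree `𝔼[deg_ω(g)]`. -/
noncomputable def expectedDegree (P : Measure (Config S)) (g : Γ) : ℝ :=
  ∫ ω, (vertexDegree (openSubgraph ω) g : ℝ) ∂P

/-- The two-point function `τ(g, h)`: the probability that `g` and `h` lie in the same cluster. -/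
noncomputable def twoPoint (P : Measure (Config S)) (g h : Γ) : ℝ :=
  P.real {ω | (openSubgraph ω).Reachable g h}

end CayleyPercolation

/-! Let a countable group act on a family of subsets ("walls") such that only finitely many walls
separate any two points. Select walls independently, each with probability `1 - exp (-ε)`, and
delete every edge crossed by a selected wall. The law is invariant because the group only permutes
i.i.d. coins. If `1` and `g` are connected, no wall separating them is selected, so `τ(1, g) ≤ exp
(-ε * #separators)`. Conversely, a geodesic survives as soon as none of the at most `K * |g|` walls
crossing its edges is selected. If at least `c * |g|` walls separate `1` from `g`, then `β = ε * K`
and `γ = ε * c` work, their ratio `K / c` does not involve `ε`, and the expected degree tends to the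
full degree as `ε → 0`. This is `exists_percolation_of_walls`.

For the lamplighter group, the walls are the translates of "the position and all lit lamps lie in a
given half-tree", together with the singletons. Each non-root vertex of the subtree spanned by the
root, the position and the lit lamps of `g` gives its own separating wall (`ncard_span_le`). A
depth-first tour of that subtree writes `g` as a word of length linear in its size (`exists_word`).
Hence the number of separators is at least linear in the word length (`exists_wordLength_le`). -/

namespace CayleyPercolation

/-! ### Walls, and the configuration left by a selection of walls -/

section Walls

variable {Γ : Type*}

/-- The set `A` separates the points `u` and `v`. -/
def Separates (A : Set Γ) (u v : Γ) : Prop := ¬(u ∈ A ↔ v ∈ A)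

/-- The sets in `W` separating `u` and `v`. -/
def separators (W : Set (Set Γ)) (u v : Γ) : Set W := {A | Separates (A : Set Γ) u v}

variable {W : Set (Set Γ)}

theorem Separates.symm {A : Set Γ} {u v : Γ} (h : Separates A u v) : Separates A v u :=
  fun h' ↦ h h'.symm

theorem separators_self (u : Γ) : separators W u u = ∅ := by
  ext A; simp [separators, Separates]

theorem separators_comm (u v : Γ) : separators W u v = separators W v u := by
  ext A; exact ⟨Separates.symm, Separates.symm⟩

theorem separators_triangle (u v w : Γ) :
    separators W u w ⊆ separators W u v ∪ separators W v w := by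
  intro A hA
  simp only [separators, Separates, Set.mem_union, Set.mem_ofPred_eq] at hA ⊢
  tauto

variable [Group Γ]

/-- The set of the edges that are not crossed by any of the walls selected by `σ`. -/
def uncrossedEdges (S : Set Γ) (W : Set (Set Γ)) (σ : W → Bool) : Config S :=
  {e | ∀ A : W, (∃ u v, (e : Sym2 Γ) = s(u, v) ∧ A ∈ separators W u v) → σ A = false}

variable {S : Set Γ}

theorem mem_uncrossedEdges_iff {σ : W → Bool} {u v : Γ}
    (h : s(u, v) ∈ (SimpleGraph.mulCayley S).edgeSet) :
    (⟨s(u, v), h⟩ : (SimpleGraph.mulCayley S).edgeSet) ∈ uncrossedEdges S W σ ↔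
      ∀ A ∈ separators W u v, σ A = false := by
  constructor
  · exact fun H A hA ↦ H A ⟨u, v, rfl, hA⟩
  · rintro H A ⟨u', v', he, hA⟩
    rcases Sym2.eq_iff.1 he with ⟨rfl, rfl⟩ | ⟨rfl, rfl⟩
    · exact H A hA
    · exact H A (separators_comm u v ▸ hA)

theorem openSubgraph_adj_iff {ω : Config S} {u v : Γ} :
    (openSubgraph ω).Adj u v ↔ ∃ h : (SimpleGraph.mulCayley S).Adj u v,
      (⟨s(u, v), h⟩ : (SimpleGraph.mulCayley S).edgeSet) ∈ ω := by
  rw [openSubgraph, SimpleGraph.fromEdgeSet_adj]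
  constructor
  · rintro ⟨⟨⟨e, he⟩, heω, rfl : e = _⟩, -⟩
    exact ⟨he, heω⟩
  · rintro ⟨h, hω⟩
    exact ⟨⟨_, hω, rfl⟩, h.ne⟩

theorem openSubgraph_uncrossedEdges_adj_iff {σ : W → Bool} {u v : Γ} :
    (openSubgraph (uncrossedEdges S W σ)).Adj u v ↔
      (SimpleGraph.mulCayley S).Adj u v ∧ ∀ A ∈ separators W u v, σ A = false := by
  rw [openSubgraph_adj_iff]
  constructor
  · rintro ⟨h, h'⟩
    exact ⟨h, (mem_uncrossedEdges_iff h).1 h'⟩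
  · rintro ⟨h, h'⟩
    exact ⟨h, (mem_uncrossedEdges_iff h).2 h'⟩

/-- A wall separating the endpoints of an open path is crossed by one of its edges. This gives the
upper bound on `τ`. -/
theorem eq_false_of_reachable {σ : W → Bool} {u v : Γ}
    (h : (openSubgraph (uncrossedEdges S W σ)).Reachable u v) :
    ∀ A ∈ separators W u v, σ A = false := by
  obtain ⟨p⟩ := h
  induction p with
  | nil => simp [separators_self]
  | cons h p ih =>
    intro A hA
    rcases separators_triangle _ _ _ hA with hA | hA
    · exact (openSubgraph_uncrossedEdges_adj_iff.1 h).2 A hA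
    · exact ih A hA

/-- The finset collects the walls crossed by the successive edges; when none is selected the whole
walk stays open. This gives the lower bound on `τ`. -/
theorem exists_finset_of_walk {K : ℕ} (hsep : ∀ u v, (separators W u v).Finite)
    (hK : ∀ u v, (SimpleGraph.mulCayley S).Adj u v → (separators W u v).ncard ≤ K)
    {u v : Γ} (p : (SimpleGraph.mulCayley S).Walk u v) :
    ∃ F : Finset W, F.card ≤ K * p.length ∧ ∀ σ : W → Bool, (∀ A ∈ F, σ A = false) →
      (openSubgraph (uncrossedEdges S W σ)).Reachable u v := by
  classical
  induction p with
  | nil => exact ⟨∅, by simp, fun σ _ ↦ .refl _⟩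
  | @cons u v w h p ih =>
    obtain ⟨F, hF, hσ⟩ := ih
    refine ⟨F ∪ (hsep u v).toFinset, ?_, fun σ h' ↦ ?_⟩
    · refine (Finset.card_union_le _ _).trans ?_
      rw [← Set.ncard_eq_toFinset_card _ (hsep u v), SimpleGraph.Walk.length_cons, mul_add, mul_one]
      exact add_le_add hF (hK u v h)
    · refine SimpleGraph.Reachable.trans (SimpleGraph.Adj.reachable ?_)
        (hσ σ fun A hA ↦ h' A (Finset.mem_union_left _ hA))
      exact openSubgraph_uncrossedEdges_adj_iff.2
        ⟨h, fun A hA ↦ h' A (Finset.mem_union_right _ ((hsep u v).mem_toFinset.2 hA))⟩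

theorem measurable_uncrossedEdges (hsep : ∀ u v, (separators W u v).Finite) :
    Measurable (uncrossedEdges S W) := by
  rw [measurable_set_iff]
  rintro ⟨e, he⟩
  induction e with | _ u v
  simp_rw [mem_uncrossedEdges_iff]
  apply measurableSet_setOfPred.1
  have : {σ : W → Bool | ∀ A ∈ separators W u v, σ A = false} =
      ⋂ A ∈ separators W u v, (fun σ : W → Bool ↦ σ A) ⁻¹' {false} := by
    ext; simp
  rw [this]
  exact (hsep u v).measurableSet_biInter fun A _ ↦ measurable_pi_apply A (measurableSet_singleton _)

theorem measurableSet_adj (u v : Γ) :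
    MeasurableSet {ω : Config S | (openSubgraph ω).Adj u v} := by
  simp_rw [openSubgraph_adj_iff]
  by_cases h : (SimpleGraph.mulCayley S).Adj u v
  · simp only [h, exists_true_left]
    exact measurableSet_setOfPred.2 (measurable_set_mem _)
  · simp [h]

theorem measurableSet_reachable [Countable Γ] (u v : Γ) :
    MeasurableSet {ω : Config S | (openSubgraph ω).Reachable u v} := by
  have key : ∀ (n : ℕ) (v : Γ), MeasurableSet
      {ω : Config S | ∃ p : (openSubgraph ω).Walk u v, p.length = n} := by
    intro n
    induction n with
    | zero =>
      intro v
      by_cases h : u = v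
      · subst h
        convert MeasurableSet.univ
        ext ω
        simp only [Set.mem_ofPred_eq, Set.mem_univ, iff_true]
        exact ⟨.nil, rfl⟩
      · convert MeasurableSet.empty
        ext ω
        simp only [Set.mem_ofPred_eq, Set.mem_empty_iff_false, iff_false]
        rintro ⟨p, hp⟩
        exact h (SimpleGraph.Walk.eq_of_length_eq_zero hp)
    | succ n ih =>
      intro v
      have : {ω : Config S | ∃ p : (openSubgraph ω).Walk u v, p.length = n + 1} =
          ⋃ w, {ω : Config S | ∃ p : (openSubgraph ω).Walk u w, p.length = n} ∩
            {ω | (openSubgraph ω).Adj w v} := by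
        ext ω
        simp only [Set.mem_ofPred_eq, Set.mem_iUnion, Set.mem_inter_iff]
        constructor
        · rintro ⟨p, hp⟩
          have hp' : ¬ p.Nil := by
            intro h
            rw [← SimpleGraph.Walk.length_eq_zero_iff] at h
            omega
          exact ⟨p.penultimate, ⟨p.dropLast, by simp [hp]⟩, p.adj_penultimate hp'⟩
        · rintro ⟨w, ⟨p, hp⟩, h⟩
          exact ⟨p.concat h, by simp [hp]⟩
      rw [this]
      exact .iUnion fun w ↦ (ih w).inter (measurableSet_adj w v)
  have : {ω : Config S | (openSubgraph ω).Reachable u v} =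
      ⋃ n, {ω : Config S | ∃ p : (openSubgraph ω).Walk u v, p.length = n} := by
    ext ω
    simp only [Set.mem_ofPred_eq, Set.mem_iUnion]
    exact ⟨fun ⟨p⟩ ↦ ⟨_, p, rfl⟩, fun ⟨_, p, _⟩ ↦ ⟨p⟩⟩
  rw [this]
  exact .iUnion fun n ↦ key n v

theorem mem_translateConfig_iff {g : Γ} {ω : Config S} {e : (SimpleGraph.mulCayley S).edgeSet} :
    e ∈ translateConfig S g ω ↔ (translate S g).mapEdgeSet.symm e ∈ ω := by
  rw [translateConfig, Equiv.image_eq_preimage_symm]; rfl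

theorem measurable_translateConfig (g : Γ) : Measurable (translateConfig S g) := by
  rw [measurable_set_iff]
  intro e
  simp_rw [mem_translateConfig_iff]
  exact measurable_set_mem _

theorem separates_translate {A : Set Γ} {g u v : Γ} :
    Separates ((g * ·) '' A) (g * u) (g * v) ↔ Separates A u v := by
  simp [Separates]

/-- The permutation of an invariant family of walls induced by a left multiplication. -/
def wallPerm (hW : ∀ g : Γ, ∀ A ∈ W, (g * ·) '' A ∈ W) (g : Γ) : W ≃ W where
  toFun A := ⟨_, hW g A A.2⟩
  invFun A := ⟨_, hW g⁻¹ A A.2⟩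
  left_inv A := by ext; simp
  right_inv A := by ext; simp

theorem wallPerm_mem_separators (hW : ∀ g : Γ, ∀ A ∈ W, (g * ·) '' A ∈ W) {g u v : Γ} {A : W} :
    wallPerm hW g A ∈ separators W (g * u) (g * v) ↔ A ∈ separators W u v :=
  separates_translate

theorem separators_eq_image_wallPerm (hW : ∀ g : Γ, ∀ A ∈ W, (g * ·) '' A ∈ W) (u v : Γ) :
    separators W u v = wallPerm hW u '' separators W 1 (u⁻¹ * v) := by
  ext A
  obtain ⟨A, rfl⟩ := (wallPerm hW u).surjective A
  rw [(wallPerm hW u).injective.mem_set_image,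
    ← wallPerm_mem_separators hW (g := u) (u := 1), mul_one, mul_inv_cancel_left]

/-- Equivariance reduces invariance of the percolation to invariance of i.i.d. coins under a
permutation of the index set. -/
theorem translateConfig_uncrossedEdges (hW : ∀ g : Γ, ∀ A ∈ W, (g * ·) '' A ∈ W) (g : Γ)
    (σ : W → Bool) :
    translateConfig S g (uncrossedEdges S W σ) =
      uncrossedEdges S W (fun A ↦ σ ((wallPerm hW g).symm A)) := by
  ext e
  obtain ⟨e, rfl⟩ := (translate S g).mapEdgeSet.surjective e
  rw [mem_translateConfig_iff, Equiv.symm_apply_apply]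
  obtain ⟨e, he⟩ := e
  induction e with | _ u v
  have h' : s(g * u, g * v) ∈ (SimpleGraph.mulCayley S).edgeSet :=
    (translate S g).map_rel_iff'.2 he
  have : (translate S g).mapEdgeSet ⟨s(u, v), he⟩ = ⟨s(g * u, g * v), h'⟩ := rfl
  rw [this, mem_uncrossedEdges_iff, mem_uncrossedEdges_iff,
    (wallPerm hW g).forall_congr_left]
  refine forall_congr' fun A ↦ imp_congr_left ?_
  rw [← wallPerm_mem_separators hW (g := g), Equiv.apply_symm_apply]

end Walls

/-! ### Independent coins -/

section Measure

/-- The law on `Bool` giving mass `e^{-ε}` to `false`. -/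
noncomputable def coin (ε : ℝ) : Measure Bool :=
  ENNReal.ofReal (Real.exp (-ε)) • Measure.dirac false +
    ENNReal.ofReal (1 - Real.exp (-ε)) • Measure.dirac true

theorem coin_singleton_false (ε : ℝ) : coin ε {false} = ENNReal.ofReal (Real.exp (-ε)) := by
  simp [coin]

theorem isProbabilityMeasure_coin {ε : ℝ} (hε : 0 ≤ ε) : IsProbabilityMeasure (coin ε) := by
  constructor
  have : Real.exp (-ε) ≤ 1 := Real.exp_le_one_iff.2 (by linarith)
  simp only [coin, Measure.coe_add, Measure.coe_smul, Pi.add_apply, Pi.smul_apply, measure_univ,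
    smul_eq_mul, mul_one]
  rw [← ENNReal.ofReal_add (Real.exp_pos _).le (by linarith)]
  simp

variable {ι : Type*}

/-- Independent tosses of the coin `coin ε`, indexed by `ι`. -/
noncomputable def coins (ι : Type*) (ε : ℝ) : Measure (ι → Bool) :=
  Measure.infinitePi fun _ ↦ coin ε

theorem isProbabilityMeasure_coins {ε : ℝ} (hε : 0 ≤ ε) : IsProbabilityMeasure (coins ι ε) := by
  have := isProbabilityMeasure_coin hε
  unfold coins
  infer_instance

theorem coins_real_false {ε : ℝ} (hε : 0 ≤ ε) (F : Finset ι) :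
    (coins ι ε).real {σ | ∀ i ∈ F, σ i = false} = Real.exp (-ε * F.card) := by
  have := isProbabilityMeasure_coin hε
  have h : {σ : ι → Bool | ∀ i ∈ F, σ i = false} = Set.pi F fun _ ↦ {false} := by
    ext; simp [Set.mem_pi]
  rw [h, measureReal_def, coins, Measure.infinitePi_pi _ fun _ _ ↦ measurableSet_singleton _]
  simp only [coin_singleton_false, Finset.prod_const, ENNReal.toReal_pow,
    ENNReal.toReal_ofReal (Real.exp_pos _).le]
  rw [← Real.exp_nat_mul, mul_comm]

theorem measurePreserving_coins {ε : ℝ} (hε : 0 ≤ ε) (e : ι ≃ ι) :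
    MeasurePreserving (fun (σ : ι → Bool) i ↦ σ (e.symm i)) (coins ι ε) (coins ι ε) := by
  have := isProbabilityMeasure_coin hε
  refine ⟨by fun_prop, ?_⟩
  have h := Measure.infinitePi_map_piCongrLeft (X := fun _ : ι ↦ Bool) (μ := fun _ ↦ coin ε) e
  have h' : (MeasurableEquiv.piCongrLeft (fun _ : ι ↦ Bool) e : (ι → Bool) → ι → Bool) =
      fun σ i ↦ σ (e.symm i) := by
    ext σ i
    obtain ⟨j, rfl⟩ := e.surjective i
    rw [Equiv.symm_apply_apply]
    exact Equiv.piCongrLeft_apply_apply (P := fun _ ↦ Bool) ..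
  rw [← h']
  exact h

end Measure

/-! ### The wall percolation: invariance, two-point function, expected degree -/

section Percolation

variable {Γ : Type*} [Group Γ] {S : Set Γ} {W : Set (Set Γ)}

/-- The law of the set of the edges that are crossed by no selected wall,
where each wall is selected independently with probability `1 - e^{-ε}`. -/
noncomputable def wallPercolation (S : Set Γ) (W : Set (Set Γ)) (ε : ℝ) : Measure (Config S) :=
  (coins W ε).map (uncrossedEdges S W)

theorem isInvariantBondPercolation_wallPercolation (hW : ∀ g : Γ, ∀ A ∈ W, (g * ·) '' A ∈ W)
    (hsep : ∀ u v, (separators W u v).Finite) {ε : ℝ} (hε : 0 ≤ ε) :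
    IsInvariantBondPercolation S (wallPercolation S W ε) := by
  have := isProbabilityMeasure_coins (ι := W) hε
  have hm := measurable_uncrossedEdges (S := S) hsep
  refine ⟨Measure.isProbabilityMeasure_map hm.aemeasurable, fun g ↦
    ⟨measurable_translateConfig g, ?_⟩⟩
  rw [wallPercolation, Measure.map_map (measurable_translateConfig g) hm]
  have h : translateConfig S g ∘ uncrossedEdges S W =
      uncrossedEdges S W ∘ fun σ A ↦ σ ((wallPerm hW g).symm A) :=
    funext fun σ ↦ translateConfig_uncrossedEdges hW g σ
  have hp := measurePreserving_coins hε (wallPerm hW g)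
  rw [h, ← Measure.map_map hm hp.measurable, hp.map_eq]

theorem twoPoint_wallPercolation_le [Countable Γ] (hsep : ∀ u v, (separators W u v).Finite)
    {ε : ℝ} (hε : 0 ≤ ε) (u v : Γ) :
    twoPoint (wallPercolation S W ε) u v ≤ Real.exp (-ε * (separators W u v).ncard) := by
  have := isProbabilityMeasure_coins (ι := W) hε
  rw [twoPoint, wallPercolation, map_measureReal_apply (measurable_uncrossedEdges hsep)
    (measurableSet_reachable u v), Set.ncard_eq_toFinset_card _ (hsep u v), ← coins_real_false hε]
  refine measureReal_mono fun σ hσ A hA ↦ ?_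
  exact eq_false_of_reachable hσ A ((hsep u v).mem_toFinset.1 hA)

theorem le_twoPoint_wallPercolation [Countable Γ] {K : ℕ}
    (hsep : ∀ u v, (separators W u v).Finite)
    (hK : ∀ u v, (SimpleGraph.mulCayley S).Adj u v → (separators W u v).ncard ≤ K)
    {ε : ℝ} (hε : 0 ≤ ε) {u v : Γ} (hconn : (SimpleGraph.mulCayley S).Reachable u v) :
    Real.exp (-(ε * K) * (SimpleGraph.mulCayley S).dist u v) ≤
      twoPoint (wallPercolation S W ε) u v := by
  have := isProbabilityMeasure_coins (ι := W) hε
  obtain ⟨p, hp⟩ := hconn.exists_walk_length_eq_dist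
  obtain ⟨F, hF, hσ⟩ := exists_finset_of_walk hsep hK p
  rw [twoPoint, wallPercolation, map_measureReal_apply (measurable_uncrossedEdges hsep)
    (measurableSet_reachable u v)]
  refine le_trans ?_ (measureReal_mono (s₁ := {σ : W → Bool | ∀ A ∈ F, σ A = false}) fun σ h ↦ hσ σ h)
  rw [coins_real_false hε, Real.exp_le_exp, ← hp]
  have : (F.card : ℝ) ≤ K * p.length := by exact_mod_cast hF
  nlinarith

theorem expectedDegree_eq_sum {P : Measure (Config S)} [IsProbabilityMeasure P] {g : Γ}
    (hfin : ((SimpleGraph.mulCayley S).neighborSet g).Finite) :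
    expectedDegree P g = ∑ v ∈ hfin.toFinset, P.real {ω | (openSubgraph ω).Adj g v} := by
  classical
  have h (ω : Config S) : (vertexDegree (openSubgraph ω) g : ℝ) =
      ∑ v ∈ hfin.toFinset, {ω : Config S | (openSubgraph ω).Adj g v}.indicator (fun _ ↦ (1 : ℝ)) ω := by
    have : (openSubgraph ω).neighborSet g =
        (hfin.toFinset.filter fun v ↦ (openSubgraph ω).Adj g v : Finset Γ) := by
      ext v
      simp only [SimpleGraph.mem_neighborSet, Finset.coe_filter, Set.Finite.mem_toFinset,
        Set.mem_ofPred_eq]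
      exact ⟨fun h ↦ ⟨(openSubgraph_adj_iff.1 h).1, h⟩, fun h ↦ h.2⟩
    rw [vertexDegree, this, Set.ncard_coe_finset]
    simp [Set.indicator_apply]
  simp_rw [expectedDegree, h]
  rw [integral_finsetSum _ fun v _ ↦
    (integrable_const (1 : ℝ)).indicator (measurableSet_adj g v)]
  refine Finset.sum_congr rfl fun v _ ↦ ?_
  exact integral_indicator_one (measurableSet_adj g v)

theorem le_expectedDegree_wallPercolation {K : ℕ}
    (hsep : ∀ u v, (separators W u v).Finite)
    (hK : ∀ u v, (SimpleGraph.mulCayley S).Adj u v → (separators W u v).ncard ≤ K)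
    {ε : ℝ} (hε : 0 ≤ ε) {g : Γ} (hfin : ((SimpleGraph.mulCayley S).neighborSet g).Finite) :
    Real.exp (-(ε * K)) * vertexDegree (SimpleGraph.mulCayley S) g ≤
      expectedDegree (wallPercolation S W ε) g := by
  have := isProbabilityMeasure_coins (ι := W) hε
  have hm := measurable_uncrossedEdges (S := S) hsep
  have : IsProbabilityMeasure (wallPercolation S W ε) :=
    Measure.isProbabilityMeasure_map hm.aemeasurable
  rw [expectedDegree_eq_sum hfin, vertexDegree, Set.ncard_eq_toFinset_card _ hfin, mul_comm,
    ← nsmul_eq_mul]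
  refine Finset.card_nsmul_le_sum _ _ _ fun v hv ↦ ?_
  have hv : (SimpleGraph.mulCayley S).Adj g v := hfin.mem_toFinset.1 hv
  rw [wallPercolation, map_measureReal_apply hm (measurableSet_adj g v)]
  refine le_trans ?_ (measureReal_mono
    (s₁ := {σ | ∀ A ∈ (hsep g v).toFinset, σ A = false}) fun σ h ↦ ?_)
  · rw [coins_real_false hε, Real.exp_le_exp, ← Set.ncard_eq_toFinset_card _ (hsep g v)]
    have : ((separators W g v).ncard : ℝ) ≤ K := by exact_mod_cast hK g v hv
    nlinarith
  · exact openSubgraph_uncrossedEdges_adj_iff.2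
      ⟨hv, fun A hA ↦ h A ((hsep g v).mem_toFinset.2 hA)⟩

end Percolation

/-! ### Cayley graphs and the general criterion -/

section CayleyGraph

variable {Γ : Type*} [Group Γ] {S : Set Γ}

theorem mulCayley_adj_iff_inv_mul_mem (hsymm : ∀ s ∈ S, s⁻¹ ∈ S) {u v : Γ} :
    (SimpleGraph.mulCayley S).Adj u v ↔ u ≠ v ∧ u⁻¹ * v ∈ S := by
  rw [SimpleGraph.mulCayley_adj']
  refine and_congr_right fun _ ↦ ⟨?_, fun h ↦ ⟨_, h, .inl (by simp)⟩⟩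
  rintro ⟨g, hg, rfl | rfl⟩
  · simpa
  · simpa using hsymm g hg

theorem finite_neighborSet (hfin : S.Finite) (hsymm : ∀ s ∈ S, s⁻¹ ∈ S) (u : Γ) :
    ((SimpleGraph.mulCayley S).neighborSet u).Finite := by
  refine (hfin.image (u * ·)).subset fun v hv ↦ ?_
  exact ⟨_, ((mulCayley_adj_iff_inv_mul_mem hsymm).1 hv).2, by simp⟩

theorem reachable_translate (g : Γ) {u v : Γ} (h : (SimpleGraph.mulCayley S).Reachable u v) :
    (SimpleGraph.mulCayley S).Reachable (g * u) (g * v) :=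
  h.map (translate S g).toHom

theorem reachable_one (hgen : Subgroup.closure S = ⊤) (g : Γ) :
    (SimpleGraph.mulCayley S).Reachable 1 g := by
  have hg : g ∈ Subgroup.closure S := hgen ▸ Subgroup.mem_top g
  induction hg using Subgroup.closure_induction with
  | mem s hs =>
    by_cases h : 1 = s
    · subst h; rfl
    · exact SimpleGraph.Adj.reachable
        ((SimpleGraph.mulCayley_adj' S 1 s).2 ⟨h, s, hs, .inl (one_mul s)⟩)
  | one => rfl
  | mul x y _ _ hx hy => exact hx.trans (by simpa using reachable_translate x hy)
  | inv x _ hx => simpa using (reachable_translate x⁻¹ hx).symm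

theorem mulCayley_connected (hgen : Subgroup.closure S = ⊤) :
    (SimpleGraph.mulCayley S).Connected :=
  ⟨fun u v ↦ (reachable_one hgen u).symm.trans (reachable_one hgen v)⟩

theorem wordLength_one : wordLength S 1 = 0 := SimpleGraph.dist_self

theorem dist_translate_le (hgen : Subgroup.closure S = ⊤) (g u v : Γ) :
    (SimpleGraph.mulCayley S).dist (g * u) (g * v) ≤ (SimpleGraph.mulCayley S).dist u v := by
  obtain ⟨p, hp⟩ := (mulCayley_connected hgen).exists_walk_length_eq_dist u v
  rw [← hp, ← SimpleGraph.Walk.length_map (translate S g).toHom p]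
  exact SimpleGraph.dist_le _

theorem wordLength_mul_le (hgen : Subgroup.closure S = ⊤) (g h : Γ) :
    wordLength S (g * h) ≤ wordLength S g + wordLength S h := by
  refine ((mulCayley_connected hgen).dist_triangle (v := g)).trans (Nat.add_le_add_left ?_ _)
  simpa [wordLength] using dist_translate_le hgen g 1 h

theorem countable_of_closure_eq_top (hfin : S.Finite) (hgen : Subgroup.closure S = ⊤) :
    Countable Γ := by
  have := hfin.countable.to_subtype
  have : Countable (FreeGroup S) := Quot.mk_surjective.countable
  refine Function.Surjective.countable (f := FreeGroup.lift ((↑) : S → Γ)) ?_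
  rw [← MonoidHom.range_eq_top, FreeGroup.range_lift_eq_closure, Subtype.range_coe, hgen]

theorem vertexDegree_pos [Nontrivial Γ] (hfin : S.Finite) (hsymm : ∀ s ∈ S, s⁻¹ ∈ S)
    (hgen : Subgroup.closure S = ⊤) : 0 < vertexDegree (SimpleGraph.mulCayley S) 1 := by
  rw [vertexDegree, Set.ncard_pos (finite_neighborSet hfin hsymm 1)]
  exact (mulCayley_connected hgen).preconnected.exists_adj_of_nontrivial 1

/-- If a group acts on a family of walls of which finitely many, and at least linearly many in the
distance, separate any two points, then it has the percolations that are asked for. -/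
theorem exists_percolation_of_walls [Nontrivial Γ] (hfin : S.Finite) (hsymm : ∀ s ∈ S, s⁻¹ ∈ S)
    (hgen : Subgroup.closure S = ⊤) {W : Set (Set Γ)}
    (hW : ∀ g : Γ, ∀ A ∈ W, (g * ·) '' A ∈ W) (hsep : ∀ u v, (separators W u v).Finite)
    {c : ℝ} (hc : 0 < c) (hlow : ∀ g, c * wordLength S g ≤ (separators W 1 g).ncard) :
    ∃ C : ℝ, 0 < C ∧ ∀ α : ℝ, α < 1 → ∃ P : Measure (Config S),
      IsInvariantBondPercolation S P ∧
      α * (vertexDegree (SimpleGraph.mulCayley S) 1 : ℝ) < expectedDegree P 1 ∧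
      ∃ β γ : ℝ, 0 < β ∧ 0 < γ ∧ β / γ ≤ C ∧ ∀ g : Γ,
        Real.exp (-β * (wordLength S g : ℝ)) ≤ twoPoint P 1 g ∧
          twoPoint P 1 g ≤ Real.exp (-γ * (wordLength S g : ℝ)) := by
  have := countable_of_closure_eq_top hfin hgen
  -- Up to translation there are only finitely many edges, so the number of walls crossing an edge
  -- is bounded. The successor taken below makes the bound positive.
  obtain ⟨K, hK0, hK⟩ : ∃ K : ℕ, 0 < K ∧
      ∀ u v, (SimpleGraph.mulCayley S).Adj u v → (separators W u v).ncard ≤ K := by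
    obtain ⟨K, hK⟩ := (hfin.image fun s ↦ (separators W 1 s).ncard).bddAbove
    refine ⟨K + 1, K.succ_pos, fun u v h ↦ ?_⟩
    rw [separators_eq_image_wallPerm hW, Set.ncard_image_of_injective _ (wallPerm hW u).injective]
    exact (hK ⟨_, ((mulCayley_adj_iff_inv_mul_mem hsymm).1 h).2, rfl⟩).trans K.le_succ
  have hK0' : (0 : ℝ) < K := by exact_mod_cast hK0
  refine ⟨K / c, by positivity, fun α hα ↦ ?_⟩
  obtain ⟨ε, hε, hεα⟩ : ∃ ε : ℝ, 0 < ε ∧ α < Real.exp (-(ε * K)) := by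
    have h1 : Filter.Tendsto (fun ε : ℝ ↦ Real.exp (-(ε * K))) (nhdsWithin 0 (Set.Ioi 0))
        (nhds 1) := by
      have : Continuous fun ε : ℝ ↦ Real.exp (-(ε * K)) := by fun_prop
      simpa using (this.tendsto 0).mono_left nhdsWithin_le_nhds
    obtain ⟨ε, h, hε⟩ := ((h1.eventually (lt_mem_nhds hα)).and self_mem_nhdsWithin).exists
    exact ⟨ε, hε, h⟩
  refine ⟨wallPercolation S W ε, isInvariantBondPercolation_wallPercolation hW hsep hε.le, ?_,
    ε * K, ε * c, by positivity, by positivity, ?_, fun g ↦ ⟨?_, ?_⟩⟩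
  · refine lt_of_lt_of_le ?_
      (le_expectedDegree_wallPercolation hsep hK hε.le (finite_neighborSet hfin hsymm 1))
    have : (0 : ℝ) < vertexDegree (SimpleGraph.mulCayley S) 1 := by
      exact_mod_cast vertexDegree_pos hfin hsymm hgen
    gcongr
  · rw [mul_div_mul_left _ _ hε.ne']
  · exact le_twoPoint_wallPercolation hsep hK hε.le (reachable_one hgen g)
  · refine (twoPoint_wallPercolation_le hsep hε.le 1 g).trans (Real.exp_le_exp.2 ?_)
    nlinarith [hlow g]

end CayleyGraph

end CayleyPercolation

/-! ### Half-trees and tours of finite subtrees in the Cayley tree of a free group -/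

namespace FreeGroup

variable {α : Type*}

theorem inv_mk_singleton (c : α × Bool) : (mk [c])⁻¹ = mk [(c.1, !c.2)] := by
  simp [inv_mk, invRev]

variable [DecidableEq α]

theorem IsReduced.toWord_mk_eq {L : List (α × Bool)} (h : IsReduced L) : (mk L).toWord = L := by
  rw [toWord_mk, h.reduce_eq]

theorem toWord_mul_mk_singleton (x : FreeGroup α) (c : α × Bool) :
    (x * mk [c]).toWord = x.toWord ++ [c] ∨
      x.toWord = (x * mk [c]).toWord ++ [(c.1, !c.2)] := by
  have hx : x * mk [c] = mk (x.toWord ++ [c]) := by rw [← mul_mk, mk_toWord]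
  have hred : IsReduced x.toWord := isReduced_toWord
  rcases List.eq_nil_or_concat x.toWord with h | ⟨L, d, h⟩
  · left
    rw [hx, h]
    exact reduce_singleton c
  · rw [List.concat_eq_append] at h
    by_cases hd : d = (c.1, !c.2)
    · right
      have hL : IsReduced L := by
        rw [h] at hred
        exact hred.infix ⟨[], [d], by simp⟩
      have : x * mk [c] = mk L := by
        rw [← mk_toWord (x := x), h, ← mul_mk, hd, ← inv_mk_singleton, inv_mul_cancel_right]
      rw [this, hL.toWord_mk_eq, h, hd]
    · left
      rw [hx]
      apply IsReduced.toWord_mk_eq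
      unfold IsReduced at hred ⊢
      refine List.isChain_append.2 ⟨hred, List.isChain_singleton _, ?_⟩
      intro a ha b hb hab
      rw [h] at ha
      simp only [List.getLast?_append, List.getLast?_singleton, Option.some_or, Option.mem_def,
        Option.some.injEq, List.head?_cons] at ha hb
      subst ha hb
      by_contra hne
      apply hd
      ext
      · exact hab
      · cases hd2 : d.2 <;> cases hc2 : c.2 <;> simp_all

/-- The elements whose reduced word starts with the letter `b`. -/
def halfTree (b : α × Bool) : Set (FreeGroup α) := {x | x.toWord.head? = some b}

theorem one_notMem_halfTree (b : α × Bool) : (1 : FreeGroup α) ∉ halfTree b := by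
  simp [halfTree]

theorem exists_mem_halfTree {x : FreeGroup α} (hx : x ≠ 1) : ∃ b, x ∈ halfTree b := by
  obtain ⟨b, L, h⟩ := List.exists_cons_of_ne_nil (mt toWord_eq_nil_iff.1 hx)
  exact ⟨b, by simp [halfTree, h]⟩

/-- Right multiplication by a letter only touches the end of the reduced word, so the first letter
can change only when one of the two words is empty. -/
theorem mul_mk_singleton_mem_halfTree_iff {x : FreeGroup α} {b c : α × Bool} (hx : x ≠ 1)
    (hxc : x * mk [c] ≠ 1) : x * mk [c] ∈ halfTree b ↔ x ∈ halfTree b := by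
  have h1 := mt toWord_eq_nil_iff.1 hx
  have h2 := mt toWord_eq_nil_iff.1 hxc
  simp only [halfTree, Set.mem_ofPred_eq]
  rcases toWord_mul_mk_singleton x c with h | h
  · rw [h, List.head?_append_of_ne_nil _ h1]
  · rw [h, List.head?_append_of_ne_nil _ h2]

theorem exists_toWord_eq_concat {x : FreeGroup α} (hx : x ≠ 1) :
    ∃ (y : FreeGroup α) (c : α × Bool), x.toWord = y.toWord ++ [c] ∧ x = y * mk [c] := by
  have hred : IsReduced x.toWord := isReduced_toWord
  rcases List.eq_nil_or_concat x.toWord with h | ⟨L, c, h⟩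
  · exact absurd (toWord_eq_nil_iff.1 h) hx
  · rw [List.concat_eq_append] at h
    rw [h] at hred
    have hL : IsReduced L := hred.infix ⟨[], [c], by simp⟩
    exact ⟨mk L, c, by rw [hL.toWord_mk_eq, h], by rw [mul_mk, ← h, mk_toWord]⟩

/-- Removing the edge that joins `t` to its parent separates from the identity exactly the elements
of which `t` is a prefix. -/
theorem inv_mul_mem_halfTree_iff {t : FreeGroup α} {b : α × Bool} (ht : t⁻¹ ∈ halfTree b)
    (z : FreeGroup α) : t⁻¹ * z ∈ halfTree b ↔ ¬ t.toWord <+: z.toWord := by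
  have ht1 : t ≠ 1 := by
    rintro rfl
    exact one_notMem_halfTree b (by simpa using ht)
  induction hn : z.norm generalizing z with
  | zero =>
    rw [norm_eq_zero] at hn
    subst hn
    simpa [ht1] using ht
  | succ n ih =>
    have hz : z ≠ 1 := by
      rintro rfl
      simp at hn
    obtain ⟨x, c, hxc, rfl⟩ := exists_toWord_eq_concat hz
    have hnx : x.norm = n := by
      simpa [norm, hxc] using hn
    by_cases h1 : t = x * mk [c]
    · subst h1
      simpa only [inv_mul_cancel, List.prefix_refl, not_true_eq_false, iff_false] using
        one_notMem_halfTree b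
    rw [hxc, List.prefix_concat_iff, ← hxc, toWord_inj, or_iff_right h1, ← mul_assoc]
    by_cases h2 : t = x
    · subst h2
      simp only [inv_mul_cancel, one_mul, List.prefix_refl, not_true_eq_false, iff_false]
      -- If `c = b`, the letter `c` cancels the last letter of `t`, so `t * mk [c]` has norm at most
      -- `n - 1`, although it has norm `n + 1`.
      intro hc
      obtain rfl : c = b := by simpa [halfTree] using hc
      obtain ⟨w, hw⟩ := List.head?_eq_some_iff.1 ht
      have hlen : w.length + 1 = n := by
        rw [← hnx, ← norm_inv_eq, norm, hw, List.length_cons]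
      have : (t * mk [c])⁻¹ = mk w := by
        rw [mul_inv_rev, ← mk_toWord (x := t⁻¹), hw, inv_mul_eq_iff_eq_mul]
        rfl
      have h3 := norm_mk_le (L₁ := w)
      rw [← this, norm_inv_eq] at h3
      omega
    · refine (mul_mk_singleton_mem_halfTree_iff ?_ ?_).trans (ih x hnx)
      · rwa [ne_eq, inv_mul_eq_one]
      · rwa [ne_eq, mul_assoc, inv_mul_eq_one]

/-- A finite subtree containing the root is traversed by a closed walk that is twice as long as its
number of edges. -/
theorem exists_closed_walk (T : Finset (FreeGroup α))
    (hT : ∀ t ∈ T, ∃ (p : FreeGroup α) (c : α × Bool),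
      t.toWord = p.toWord ++ [c] ∧ t = p * mk [c] ∧ (p = 1 ∨ p ∈ T)) :
    ∃ ws : List (α × Bool), ws.length = 2 * T.card ∧ mk ws = 1 ∧
      ∀ t, t = 1 ∨ t ∈ T → ∃ p, p <+: ws ∧ mk p = t := by
  induction hn : T.card generalizing T with
  | zero =>
    rw [Finset.card_eq_zero] at hn
    subst hn
    exact ⟨[], rfl, rfl, fun t ht ↦ ⟨[], List.prefix_refl _, by
      simpa [eq_comm, one_eq_mk] using ht⟩⟩
  | succ n ih =>
    -- An element of maximal norm is a leaf, so erasing it keeps the set closed under parents. The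
    -- tour of the rest is then extended by a detour to `t` and back, inserted where it visits the
    -- parent.
    obtain ⟨t, ht, hmax⟩ := T.exists_max_image norm (Finset.card_pos.1 (by omega))
    obtain ⟨ws, hlen, hone, hvis⟩ := ih (T.erase t) (fun s hs ↦ by
      rw [Finset.mem_erase] at hs
      obtain ⟨p, c, h1, h2, h3⟩ := hT s hs.2
      refine ⟨p, c, h1, h2, h3.imp_right fun hp ↦ Finset.mem_erase.2 ⟨?_, hp⟩⟩
      rintro rfl
      have := hmax s hs.2
      simp [norm, h1] at this) (by rw [Finset.card_erase_of_mem ht, hn]; rfl)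
    obtain ⟨p, c, h1, h2, h3⟩ := hT t ht
    obtain ⟨a, ⟨b, rfl⟩, ha⟩ := hvis p (h3.imp_right fun hp ↦ Finset.mem_erase.2 ⟨by
      rintro rfl
      simp at h1, hp⟩)
    have hback (L : List (α × Bool)) : mk (a ++ [c, (c.1, !c.2)] ++ L) = mk (a ++ L) := by
      have : mk [c, (c.1, !c.2)] = 1 := by
        rw [← List.singleton_append, ← mul_mk, ← inv_mk_singleton, mul_inv_cancel]
      simp only [← mul_mk, this, mul_one]
    refine ⟨a ++ [c, (c.1, !c.2)] ++ b, ?_, (hback b).trans hone, fun s hs ↦ ?_⟩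
    · simp only [List.length_append, List.length_cons, List.length_nil] at hlen ⊢
      omega
    by_cases hst : s = t
    · subst hst
      exact ⟨a ++ [c], ⟨(c.1, !c.2) :: b, by simp⟩, by rw [← mul_mk, ha, ← h2]⟩
    · obtain ⟨q, hq, rfl⟩ := hvis s (hs.imp_right fun h ↦ Finset.mem_erase.2 ⟨hst, h⟩)
      -- A visit before the detour is unaffected; a later one has the detour inserted into its
      -- prefix, which does not move its endpoint.
      rcases List.prefix_or_prefix_of_prefix hq (List.prefix_append a b) with h | ⟨q', rfl⟩
      · exact ⟨q, h.trans ⟨[c, (c.1, !c.2)] ++ b, by simp⟩, rfl⟩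
      · exact ⟨_, (List.prefix_append_right_inj _).2 ((List.prefix_append_right_inj a).1 hq),
          hback q'⟩

end FreeGroup

/-! ### Generators and walls of the lamplighter group -/

namespace LamplighterGroup

open FreeGroup CayleyPercolation

variable {H : Type*} [Group H] {r : ℕ}

theorem ext {g h : LamplighterGroup H r} (hl : ∀ z, g.1.left z = h.1.left z)
    (hr : g.1.right = h.1.right) : g = h :=
  Subtype.ext (RegularWreathProduct.ext (funext hl) hr)

/-- The element that changes the lamp at the identity by `h`. -/
def lamp (h : H) : LamplighterGroup H r :=
  ⟨⟨Pi.mulSingle 1 h, 1⟩, (Set.finite_singleton 1).subset Pi.mulSupport_mulSingle_subset⟩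

/-- The element that moves the lamplighter by `x`. -/
def move (x : FreeGroup (Fin r)) : LamplighterGroup H r :=
  ⟨⟨1, x⟩, by simp [RestrictedWreathProduct]⟩

variable (H r) in
/-- The standard generators: changing the lamp at the current position, and moving by a letter. -/
def generators : Set (LamplighterGroup H r) :=
  Set.range lamp ∪ Set.range fun c : Fin r × Bool ↦ move (FreeGroup.mk [c])

theorem finite_generators [Finite H] : (generators H r).Finite :=
  (Set.finite_range _).union (Set.finite_range _)

theorem inv_mem_generators {s : LamplighterGroup H r} (hs : s ∈ generators H r) :
    s⁻¹ ∈ generators H r := by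
  rcases hs with ⟨h, rfl⟩ | ⟨c, rfl⟩
  · refine .inl ⟨h⁻¹, LamplighterGroup.ext (fun z ↦ ?_) ?_⟩
    · simp [lamp, Pi.mulSingle_inv]
    · simp [lamp]
  · refine .inr ⟨(c.1, !c.2), LamplighterGroup.ext (fun z ↦ ?_) ?_⟩
    · simp [move]
    · simp [move, ← inv_mk_singleton]

/-- The walls `{(φ, x) | x ∈ t B, φ = 1 outside t B}`, where `B` is the half-tree of the words
starting with `b`. -/
def wall (t : FreeGroup (Fin r)) (b : Fin r × Bool) : Set (LamplighterGroup H r) :=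
  {g | t⁻¹ * g.1.right ∈ halfTree b ∧ ∀ z, t⁻¹ * z ∉ halfTree b → g.1.left z = 1}

variable (H r) in
/-- The family of all the translates of the walls `wall 1 b`, and all the singletons. -/
def walls : Set (Set (LamplighterGroup H r)) :=
  {A | (∃ g b, A = (g * ·) '' wall 1 b) ∨ ∃ g, A = {g}}

theorem image_mem_walls (g : LamplighterGroup H r) (A : Set (LamplighterGroup H r))
    (hA : A ∈ walls H r) : (g * ·) '' A ∈ walls H r := by
  rcases hA with ⟨h, b, rfl⟩ | ⟨h, rfl⟩
  · exact .inl ⟨g * h, b, by simp only [Set.image_image, mul_assoc]⟩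
  · exact .inr ⟨g * h, by simp only [Set.image_singleton]⟩

/-- In general a translate prescribes the lamps of `g` outside the half-tree; the hypothesis says
that these are trivial there. -/
theorem image_wall_one {g : LamplighterGroup H r} {b : Fin r × Bool}
    (hg : ∀ z, g.1.right⁻¹ * z ∉ halfTree b → g.1.left z = 1) :
    (g * ·) '' wall 1 b = wall g.1.right b := by
  ext k
  rw [Set.image_mul_left, Set.mem_preimage]
  simp only [wall, inv_one, one_mul, Set.mem_ofPred_eq]
  refine and_congr Iff.rfl ⟨fun h z hz ↦ ?_, fun h z hz ↦ ?_⟩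
  · simpa [hg z hz] using h _ hz
  · have hz' : g.1.right⁻¹ * (g.1.right * z) ∉ halfTree b := by simpa using hz
    simp [hg _ hz', h _ hz']

theorem wall_mem_walls (t : FreeGroup (Fin r)) (b : Fin r × Bool) : wall t b ∈ walls H r :=
  .inl ⟨move t, b, (image_wall_one (g := move t) fun _ _ ↦ rfl).symm⟩

theorem eq_wall_of_one_mem {A : Set (LamplighterGroup H r)} (hA : A ∈ walls H r) (h1 : 1 ∈ A) :
    A = {1} ∨ ∃ t b, t⁻¹ ∈ halfTree b ∧ A = wall t b := by
  rcases hA with ⟨g, b, rfl⟩ | ⟨g, rfl⟩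
  · right
    rw [Set.image_mul_left, Set.mem_preimage] at h1
    simp only [wall, inv_one, one_mul, mul_one, Set.mem_ofPred_eq] at h1
    refine ⟨g.1.right, b, h1.1, image_wall_one fun z hz ↦ ?_⟩
    simpa using h1.2 _ hz
  · left
    rw [Set.mem_singleton_iff.1 h1]

/-- A wall other than `{1}` that contains `1` is attached to a half-tree containing the root.
Changing the lamp at the root does not leave it, and moving by a letter leaves it only across the
edge joining the root to that letter. -/
theorem finite_walls_of_mem_generators {s : LamplighterGroup H r} (hs : s ∈ generators H r) :
    {A ∈ walls H r | 1 ∈ A ∧ s ∉ A}.Finite := by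
  rcases hs with ⟨h, rfl⟩ | ⟨c, rfl⟩
  · refine (Set.finite_singleton {1}).subset fun A ⟨hA, h1, hs⟩ ↦ ?_
    rcases eq_wall_of_one_mem hA h1 with h' | ⟨t, b, htb, rfl⟩
    · exact h'
    · refine absurd ⟨by simpa [lamp] using htb, fun z hz ↦ ?_⟩ hs
      refine Pi.mulSingle_eq_of_ne ?_ _
      rintro rfl
      exact hz (by simpa using htb)
  · refine ((Set.finite_singleton {1}).union
      (Set.finite_range fun b ↦ wall (FreeGroup.mk [c]) b)).subset fun A ⟨hA, h1, hs⟩ ↦ ?_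
    rcases eq_wall_of_one_mem hA h1 with h' | ⟨t, b, htb, rfl⟩
    · exact .inl h'
    · refine .inr ⟨b, ?_⟩
      obtain rfl : t = FreeGroup.mk [c] := by
        by_contra hne
        refine hs ⟨(mul_mk_singleton_mem_halfTree_iff ?_ ?_).2 htb, fun z _ ↦ rfl⟩
        · intro h
          exact one_notMem_halfTree b (h ▸ htb)
        · rwa [ne_eq, inv_mul_eq_one]
      rfl

/-! ### Short words from tours of the spanned subtree -/

/-- The nontrivial vertices of the subtree spanned by the identity, the position and the lit lamps
of `g`. -/
def span (g : LamplighterGroup H r) : Set (FreeGroup (Fin r)) :=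
  {t | t ≠ 1 ∧ ∃ z, (z = g.1.right ∨ g.1.left z ≠ 1) ∧ t.toWord <+: z.toWord}

theorem finite_span (g : LamplighterGroup H r) : (span g).Finite := by
  have h : ({g.1.right} ∪ Function.mulSupport g.1.left).Finite :=
    (Set.finite_singleton _).union g.2
  refine ((h.biUnion fun z _ ↦ (z.toWord.inits.finite_toSet).image FreeGroup.mk)).subset ?_
  rintro t ⟨-, z, hz, ht⟩
  exact Set.mem_biUnion (x := z) hz ⟨t.toWord, (List.mem_inits _ _).2 ht, mk_toWord⟩

/-- The lamplighter can light, along a walk, any configuration of visited lamps. -/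
theorem exists_word_of_walk (ws : List (Fin r × Bool)) (g : LamplighterGroup H r)
    (hr : g.1.right = FreeGroup.mk ws)
    (hl : ∀ z, g.1.left z ≠ 1 → ∃ p, p <+: ws ∧ FreeGroup.mk p = z) :
    ∃ l : List (LamplighterGroup H r), (∀ s ∈ l, s ∈ generators H r) ∧ l.prod = g ∧
      l.length ≤ 2 * ws.length + 1 := by
  induction ws generalizing g with
  | nil =>
    refine ⟨[lamp (g.1.left 1)], by simp [generators], ?_, by simp⟩
    rw [List.prod_singleton]
    refine LamplighterGroup.ext (fun z ↦ ?_) hr.symm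
    by_cases hz : z = 1
    · subst hz; simp [lamp]
    · rw [show (lamp (g.1.left 1)).1.left z = 1 from Pi.mulSingle_eq_of_ne hz _]
      by_contra h
      obtain ⟨p, hp, rfl⟩ := hl z (Ne.symm h)
      exact hz (by rw [List.prefix_nil.1 hp]; rfl)
  | cons c ws ih =>
    -- Set the lamp at the current position, take one step, and view what remains from the new
    -- position. The lamp just left now needs no change, even if the walk returns to it.
    set k : LamplighterGroup H r := (lamp (g.1.left 1) * move (FreeGroup.mk [c]))⁻¹ * g with hk
    have hkr : k.1.right = FreeGroup.mk ws := by
      have : g.1.right = FreeGroup.mk [c] * FreeGroup.mk ws := hr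
      simp [hk, lamp, move, this, - mul_mk, -inv_mk]
    have hkl (z) : k.1.left z =
        (Pi.mulSingle (M := fun _ ↦ H) 1 (g.1.left 1) (FreeGroup.mk [c] * z))⁻¹ *
          g.1.left (FreeGroup.mk [c] * z) := by
      simp [hk, lamp, move, - mul_mk, -inv_mk]
    obtain ⟨l, h1, h2, h3⟩ := ih k hkr fun z hz ↦ by
      rw [hkl] at hz
      by_cases hcz : FreeGroup.mk [c] * z = 1
      · simp [hcz] at hz
      · rw [Pi.mulSingle_eq_of_ne hcz, inv_one, one_mul] at hz
        obtain ⟨p, hp, hpz⟩ := hl _ hz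
        rcases List.prefix_cons_iff.1 hp with rfl | ⟨q, rfl, hq⟩
        · exact absurd hpz.symm hcz
        · exact ⟨q, hq, mul_left_cancel (a := FreeGroup.mk [c]) (by rw [← hpz]; rfl)⟩
    refine ⟨lamp (g.1.left 1) :: move (FreeGroup.mk [c]) :: l, ?_, ?_, ?_⟩
    · simp only [List.mem_cons, forall_eq_or_imp]
      exact ⟨.inl ⟨_, rfl⟩, .inr ⟨c, rfl⟩, h1⟩
    · rw [List.prod_cons, List.prod_cons, h2, hk, ← mul_assoc, mul_inv_cancel_left]
    · simp only [List.length_cons]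
      omega

theorem exists_word (g : LamplighterGroup H r) :
    ∃ l : List (LamplighterGroup H r), (∀ s ∈ l, s ∈ generators H r) ∧ l.prod = g ∧
      l.length ≤ 8 * (span g).ncard + 1 := by
  obtain ⟨ws, hlen, hone, hvis⟩ := exists_closed_walk (finite_span g).toFinset fun t ht ↦ by
    obtain ⟨ht1, z, hz, htz⟩ := (finite_span g).mem_toFinset.1 ht
    obtain ⟨p, c, h1, h2⟩ := exists_toWord_eq_concat ht1
    refine ⟨p, c, h1, h2, or_iff_not_imp_left.2 fun hp ↦ (finite_span g).mem_toFinset.2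
      ⟨hp, z, hz, List.IsPrefix.trans ⟨[c], h1.symm⟩ htz⟩⟩
  have hvis' (z) (hz : z = g.1.right ∨ g.1.left z ≠ 1) : ∃ p, p <+: ws ∧ FreeGroup.mk p = z :=
    hvis z (or_iff_not_imp_left.2 fun h ↦ (finite_span g).mem_toFinset.2
      ⟨h, z, hz, List.prefix_refl _⟩)
  obtain ⟨q, hq, hqr⟩ := hvis' _ (.inl rfl)
  -- The closed tour `ws` reaches every lit lamp; its prefix `q` then leads to the final position.
  -- Both have length at most `2 * (span g).ncard`, whence the factor 8.
  obtain ⟨l, h1, h2, h3⟩ := exists_word_of_walk (ws ++ q) g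
    (by rw [← mul_mk, hone, one_mul, hqr]) fun z hz ↦ by
      obtain ⟨p, hp, hpz⟩ := hvis' z (.inr hz)
      exact ⟨p, hp.trans (List.prefix_append _ _), hpz⟩
  refine ⟨l, h1, h2, h3.trans ?_⟩
  have := hq.length_le
  rw [List.length_append, Set.ncard_eq_toFinset_card _ (finite_span g)]
  omega

/-! ### Finiteness and linear growth of the separating walls -/

/-- Walls containing `s` but not `1` are the translates by `s` of walls containing `1` but not
`s⁻¹`, so the one-sided count for `s` and `s⁻¹` suffices. -/
theorem finite_separators_one_of_mem_generators {s : LamplighterGroup H r}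
    (hs : s ∈ generators H r) : (separators (walls H r) 1 s).Finite := by
  have h1 := finite_walls_of_mem_generators hs
  have h2 := (finite_walls_of_mem_generators (inv_mem_generators hs)).image ((s * ·) '' ·)
  refine Set.Finite.of_finite_image ((h1.union h2).subset ?_) Subtype.val_injective.injOn
  rintro _ ⟨⟨A, hA⟩, hsep, rfl⟩
  simp only [separators, Separates, Set.mem_ofPred_eq] at hsep
  by_cases h : 1 ∈ A
  · exact .inl ⟨hA, h, by tauto⟩
  · refine .inr ⟨(s⁻¹ * ·) '' A, ⟨image_mem_walls _ A hA, ?_, ?_⟩, ?_⟩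
    · simp only [Set.image_mul_left, inv_inv, Set.mem_preimage, mul_one]
      tauto
    · simpa using h
    · ext; simp

theorem finite_separators (u v : LamplighterGroup H r) :
    (separators (walls H r) u v).Finite := by
  rw [separators_eq_image_wallPerm image_mem_walls]
  refine Set.Finite.image _ ?_
  obtain ⟨l, hl, hprod, -⟩ := exists_word (u⁻¹ * v)
  rw [← hprod]
  clear hprod
  induction l with
  | nil => simp [separators_self]
  | cons s l ih =>
    rw [List.forall_mem_cons] at hl
    rw [List.prod_cons]
    refine ((finite_separators_one_of_mem_generators hl.1).union ?_).subset
      (separators_triangle 1 s (s * l.prod))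
    rw [separators_eq_image_wallPerm image_mem_walls, inv_mul_cancel_left]
    exact (ih hl.2).image _

/-- Send `t` to the wall of the root side of the edge from `t` to its parent. It contains `1` but
not `g`, whose position or some lit lamp lies beyond `t`. -/
theorem ncard_span_le (g : LamplighterGroup H r) :
    (span g).ncard ≤ (separators (walls H r) 1 g).ncard := by
  rcases (span g).eq_empty_or_nonempty with h | ⟨t₀, ht₀⟩
  · simp [h]
  have hb (t : FreeGroup (Fin r)) (ht : t ∈ span g) : ∃ b, t⁻¹ ∈ halfTree b :=
    exists_mem_halfTree (inv_ne_one.2 ht.1)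
  have : Nonempty (Fin r × Bool) := ⟨(hb t₀ ht₀).choose⟩
  choose! b hb using hb
  refine Set.ncard_le_ncard_of_injOn (fun t ↦ ⟨wall t (b t), wall_mem_walls _ _⟩) ?_ ?_
    (finite_separators 1 g)
  · intro t ht hiff
    obtain ⟨z, hz, htz⟩ := ht.2
    have h1 : (1 : LamplighterGroup H r) ∈ wall t (b t) :=
      ⟨by simpa using hb t ht, fun _ _ ↦ rfl⟩
    have hg := hiff.1 h1
    have hz' : t⁻¹ * z ∉ halfTree (b t) := fun h ↦
      (inv_mul_mem_halfTree_iff (hb t ht) z).1 h htz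
    rcases hz with rfl | hz
    · exact hz' hg.1
    · exact hz (hg.2 z hz')
  -- The wall at `t` recovers `t`: it contains `move s` whenever `t` is not a prefix of `s`, whereas
  -- the wall at `s` never contains `move s`.
  · have key (s t) (hs : s ∈ span g) (ht : t ∈ span g)
        (h : wall (H := H) s (b s) = wall t (b t)) : t.toWord <+: s.toWord := by
      by_contra hst
      rw [← inv_mul_mem_halfTree_iff (hb t ht)] at hst
      have h1 : move s ∈ wall (H := H) t (b t) := ⟨hst, fun _ _ ↦ rfl⟩
      rw [← h] at h1
      refine one_notMem_halfTree (b s) ?_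
      simpa [move] using h1.1
    intro s hs t ht h
    have h' := congrArg Subtype.val h
    exact toWord_injective ((key t s ht hs h'.symm).eq_of_length_le (key s t hs ht h').length_le)

/-- This is why singletons are among the walls: if only the lamp at the root is changed, the spanned
subtree has no edge. -/
theorem one_le_ncard_separators {g : LamplighterGroup H r} (hg : g ≠ 1) :
    1 ≤ (separators (walls H r) 1 g).ncard := by
  rw [Nat.one_le_iff_ne_zero, ← Nat.pos_iff_ne_zero, Set.ncard_pos (finite_separators 1 g)]
  exact ⟨⟨{1}, .inr ⟨1, rfl⟩⟩, fun h ↦ hg (h.1 rfl)⟩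

theorem exists_wordLength_le [Finite H] {S : Set (LamplighterGroup H r)}
    (hgen : Subgroup.closure S = ⊤) :
    ∃ K : ℕ, 0 < K ∧ ∀ g, wordLength S g ≤ K * (separators (walls H r) 1 g).ncard := by
  obtain ⟨K, hK⟩ := ((finite_generators (H := H) (r := r)).image (wordLength S)).bddAbove
  have hlist (l : List (LamplighterGroup H r)) (hl : ∀ s ∈ l, s ∈ generators H r) :
      wordLength S l.prod ≤ K * l.length := by
    induction l with
    | nil => simp [wordLength_one]
    | cons s l ih =>
      rw [List.forall_mem_cons] at hl
      rw [List.prod_cons, List.length_cons, mul_add, mul_one, add_comm]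
      exact (wordLength_mul_le hgen _ _).trans (add_le_add (hK ⟨s, hl.1, rfl⟩) (ih hl.2))
  -- With `n` separators and `n ≥ 1`, the word has length at most `8 * n + 1 ≤ 9 * n`; `K + 1`
  -- replaces `K` to make the constant positive.
  refine ⟨9 * (K + 1), by omega, fun g ↦ ?_⟩
  by_cases hg : g = 1
  · subst hg; simp [wordLength_one]
  obtain ⟨l, hl, rfl, hlen⟩ := exists_word g
  have h1 := hlist l hl
  have h2 := ncard_span_le l.prod
  have h3 := one_le_ncard_separators hg
  nlinarith

theorem nontrivial (hr : 1 ≤ r) : Nontrivial (LamplighterGroup H r) := by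
  have : Nonempty (Fin r) := ⟨⟨0, hr⟩⟩
  obtain ⟨x, hx⟩ := exists_ne (1 : FreeGroup (Fin r))
  exact ⟨move x, 1, fun h ↦ hx (congrArg (fun g ↦ g.1.right) h)⟩

end LamplighterGroup

theorem theorem1p5 {H : Type*} [Group H] [Finite H] (r : ℕ) (hr : 1 ≤ r)
    (S : Set (LamplighterGroup H r)) (hfin : S.Finite) (hsymm : ∀ s ∈ S, s⁻¹ ∈ S)
    (hgen : Subgroup.closure S = ⊤) :
    ∃ C : ℝ, 0 < C ∧ ∀ α : ℝ, α < 1 →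
      ∃ P : MeasureTheory.Measure (CayleyPercolation.Config S),
        CayleyPercolation.IsInvariantBondPercolation S P ∧
        α * (vertexDegree (SimpleGraph.mulCayley S) 1 : ℝ)
          < CayleyPercolation.expectedDegree P 1 ∧
        ∃ β γ : ℝ, 0 < β ∧ 0 < γ ∧ β / γ ≤ C ∧
          ∀ g : LamplighterGroup H r,
            Real.exp (-β * (CayleyPercolation.wordLength S g : ℝ))
                ≤ CayleyPercolation.twoPoint P 1 g ∧
              CayleyPercolation.twoPoint P 1 g
                ≤ Real.exp (-γ * (CayleyPercolation.wordLength S g : ℝ)) := by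
  have : Nontrivial (LamplighterGroup H r) := LamplighterGroup.nontrivial hr
  obtain ⟨K, hK0, hK⟩ := LamplighterGroup.exists_wordLength_le hgen
  have hK0' : (0 : ℝ) < K := by exact_mod_cast hK0
  refine CayleyPercolation.exists_percolation_of_walls hfin hsymm hgen
    LamplighterGroup.image_mem_walls LamplighterGroup.finite_separators (c := (K : ℝ)⁻¹)
    (inv_pos.2 hK0') fun g ↦ ?_
  rw [inv_mul_le_iff₀ hK0']
  exact_mod_cast hK g
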